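/- All graphs are finite, have at least one vertex, may have parallel edges, and have no loops. A path in a graph $H$ from $u$ to $w$ is a walk from $u$ to $w$ (a sequence of vertices together with the sequence of edges joining consecutive ones) whose vertices are distinct; its order is its number of vertices, and the one-vertex path is allowed. A path $P$ from $u$ to $w$ is a unique shortest path if no path from $u$ to $w$ has smaller order and every path from $u$ to $w$ of the same order has the same vertices and the same edges as $P$. The spectator number of $H$ is $|V(H)|$ minus the largest order of a unique shortest path in $H$. A graph $G$ is a minor of $H$ if, up to isomorphism, $G$ is obtained from $H$ by a finite sequence of the following operations: deletion of an isolated vertex; deletion of an edge; contraction of an edge that has no other edge in parallel with it. The spectator floor of $G$ is the minimum of the spectator numbers of all graphs $H$ of which $G$ is a minor. Theorem. For every graph $G$ there is a graph $G'$ with the same vertex set as $G$ such that $G$ is a subgraph of $G'$ (that is, $G'$ is obtained from $G$ by adding edges only) and such that the spectator number of $G'$ is equal to the spectator floor of $G$. -/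

import Mathlib

universe u v

namespace Graph

section Definitions

variable {α α' β β' γ : Type*}

/-- The standing convention on multigraphs: finite, with at least one vertex, parallel edges
allowed, loops not allowed. -/
structure IsFiniteMultigraph (G : Graph α β) : Prop where
  vertexSet_nonempty : V(G).Nonempty
  vertexSet_finite : V(G).Finite
  edgeSet_finite : E(G).Finite
  loopless : G.Loopless

/-! ### Paths, shortest paths, unique shortest paths -/

/-- `G.IsWalk u p w`: the list `p = [(e₁, v₂), …, (e_k, v_{k+1})]` describes a walk of length `k` in
`G` from `u = v₁` to `w = v_{k+1}`, in which `e_i` has the ends `v_i` and `v_{i+1}`. -/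
def IsWalk (G : Graph α β) : α → List (β × α) → α → Prop
  | u, [], w => u ∈ V(G) ∧ u = w
  | u, s :: p, w => G.IsLink s.1 u s.2 ∧ G.IsWalk s.2 p w

/-- A path is a walk all of whose vertices are distinct. -/
def IsPath (G : Graph α β) (u : α) (p : List (β × α)) (w : α) : Prop :=
  G.IsWalk u p w ∧ (u :: p.map Prod.snd).Nodup

/-- A path from `u` to `w` such that no path from `u` to `w` is shorter. -/
def IsShortestPath (G : Graph α β) (u : α) (p : List (β × α)) (w : α) : Prop :=
  G.IsPath u p w ∧ ∀ q, G.IsPath u q w → p.length ≤ q.length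

/-- A shortest path from `u` to `w` such that every path from `u` to `w` of the same length is
identical to it, in its vertices and in its edges. -/
def IsUniqueShortestPath (G : Graph α β) (u : α) (p : List (β × α)) (w : α) : Prop :=
  G.IsShortestPath u p w ∧ ∀ q, G.IsPath u q w → q.length = p.length → q = p

/-- The set of the orders (numbers of vertices) of the unique shortest paths in `G`. -/
def uniqueShortestPathOrders (G : Graph α β) : Set ℕ :=
  {k | ∃ u p w, G.IsUniqueShortestPath u p w ∧ k = p.length + 1}

/-- The parade number: the largest order of a unique shortest path in `G`. -/
noncomputable def paradeNumber (G : Graph α β) : ℕ := sSup G.uniqueShortestPathOrders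

/-- The spectator number: the number of vertices outside a longest unique shortest path. -/
noncomputable def spectatorNumber (G : Graph α β) : ℕ := V(G).ncard - G.paradeNumber

/-! ### Minors -/

open Classical in
/-- Delete the edge `e`, with ends `x` and `y`, and identify `y` with `x`. -/
noncomputable def contractEdge (H : Graph α β) (e : β) (x y : α) : Graph α β :=
  (H.deleteEdges {e}).map (fun z => if z = y then x else z)

/-- `IsElementaryMinor H K`: the graph `K` is obtained from `H` by deleting an isolated vertex, or
by deleting an edge, or by contracting an edge that has no other edge in parallel with it. -/
inductive IsElementaryMinor (H : Graph α β) : Graph α β → Prop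
  | deleteVertex (x : α) (hx : x ∈ V(H)) (hiso : ∀ e, ¬ H.Inc e x) :
      IsElementaryMinor H (H.deleteVerts {x})
  | deleteEdge (e : β) (he : e ∈ E(H)) : IsElementaryMinor H (H.deleteEdges {e})
  | contract (e : β) (x y : α) (he : H.IsLink e x y) (hpar : ∀ f, H.IsLink f x y → f = e) :
      IsElementaryMinor H (H.contractEdge e x y)

/-- An isomorphism of multigraphs. -/
structure Iso (G : Graph α β) (H : Graph α' β') where
  vertexEquiv : V(G) ≃ V(H)
  edgeEquiv : E(G) ≃ E(H)
  isLink_iff : ∀ (e : E(G)) (x y : V(G)),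
    G.IsLink e x y ↔ H.IsLink (edgeEquiv e) (vertexEquiv x) (vertexEquiv y)

/-- `G` is a minor of `H`: up to isomorphism, `G` is obtained from `H` by a finite sequence of
elementary minor operations. -/
def IsMinor (G : Graph α β) (H : Graph α' β') : Prop :=
  ∃ K : Graph α' β', Relation.ReflTransGen IsElementaryMinor H K ∧ Nonempty (G.Iso K)

/-- The spectator numbers of all graphs of which `G` is a minor. -/
def spectatorNumbersAbove {α : Type u} {β : Type v} (G : Graph α β) : Set ℕ :=
  {k | ∃ (V : Type u) (E : Type v) (H : Graph V E),
    H.IsFiniteMultigraph ∧ G.IsMinor H ∧ k = H.spectatorNumber}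

/-- The spectator floor: the minimum of the spectator number over all graphs of which `G` is a
minor. -/
noncomputable def spectatorFloor {α : Type u} {β : Type v} (G : Graph α β) : ℕ :=
  sInf G.spectatorNumbersAbove

/-- The graph `G` with its edges renamed along an injection. -/
def relabelEdges (G : Graph α β) (f : β ↪ γ) : Graph α γ where
  vertexSet := V(G)
  IsLink e' x y := ∃ e, f e = e' ∧ G.IsLink e x y
  isLink_symm _ _ := ⟨fun _ _ ⟨e, he, h⟩ => ⟨e, he, h.symm⟩⟩
  eq_or_eq_of_isLink_of_isLink := by
    rintro _ x y z w ⟨e, rfl, h⟩ ⟨e', he', h'⟩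
    obtain rfl := f.injective he'
    exact h.left_eq_or_eq h'
  left_mem_of_isLink := by
    rintro _ x y ⟨e, _, h⟩
    exact h.left_mem

/-! ### The maxima and minima above are attained -/

theorem IsWalk.mem {G : Graph α β} {w : α} : ∀ {p : List (β × α)} {u : α}, G.IsWalk u p w →
    ∀ x ∈ u :: p.map Prod.snd, x ∈ V(G)
  | [], u, h => by simpa using h.1
  | s :: p, u, h => by
    intro x hx
    rcases List.mem_cons.1 hx with rfl | hx
    · exact h.1.left_mem
    · exact IsWalk.mem h.2 x (by simpa using hx)

theorem IsPath.order_le {G : Graph α β} (hG : V(G).Finite) {u w : α} {p : List (β × α)}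
    (h : G.IsPath u p w) : p.length + 1 ≤ V(G).ncard := by
  classical
  have h1 := List.toFinset_card_of_nodup h.2
  have h2 : (((u :: p.map Prod.snd).toFinset : Finset α) : Set α) ⊆ V(G) := by
    intro x hx
    exact h.1.mem x (by simpa using hx)
  have h3 := Set.ncard_le_ncard h2 hG
  rw [Set.ncard_coe_finset, h1] at h3
  simpa using h3

theorem isUniqueShortestPath_nil {G : Graph α β} {u : α} (hu : u ∈ V(G)) :
    G.IsUniqueShortestPath u [] u :=
  ⟨⟨⟨⟨hu, rfl⟩, by simp⟩, fun _ _ => by simp⟩, fun _ _ h => List.length_eq_zero_iff.1 h⟩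

/-- The parade number is the order of a longest unique shortest path. -/
theorem isGreatest_paradeNumber {G : Graph α β} (hG : G.IsFiniteMultigraph) :
    IsGreatest G.uniqueShortestPathOrders G.paradeNumber := by
  obtain ⟨u, hu⟩ := hG.vertexSet_nonempty
  have hb : BddAbove G.uniqueShortestPathOrders := by
    refine ⟨V(G).ncard, ?_⟩
    rintro k ⟨a, p, b, h, rfl⟩
    exact h.1.1.order_le hG.vertexSet_finite
  exact ⟨Nat.sSup_mem ⟨_, u, [], u, isUniqueShortestPath_nil hu, rfl⟩ hb,
    fun k hk => le_csSup hb hk⟩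

/-- The subtraction in the definition of the spectator number does not truncate. -/
theorem paradeNumber_add_spectatorNumber {G : Graph α β} (hG : G.IsFiniteMultigraph) :
    G.paradeNumber + G.spectatorNumber = V(G).ncard := by
  obtain ⟨u, p, w, h, hk⟩ := (isGreatest_paradeNumber hG).1
  have := h.1.1.order_le hG.vertexSet_finite
  unfold spectatorNumber
  omega

/-- The spectator floor is a minimum. -/
theorem isLeast_spectatorFloor {α : Type u} {β : Type v} {G : Graph α β}
    (hG : G.IsFiniteMultigraph) : IsLeast G.spectatorNumbersAbove G.spectatorFloor :=
  ⟨Nat.sInf_mem ⟨_, α, β, G, hG,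
    ⟨G, .refl, ⟨⟨Equiv.refl _, Equiv.refl _, fun _ _ _ => Iff.rfl⟩⟩⟩, rfl⟩,
    fun _ hk => Nat.sInf_le hk⟩

end Definitions

end Graph

/-!
The proof replaces unique shortest paths by a local certificate that survives the passage to minors.
A *levelling* of order `k` of a graph `G` (`Graph.IsLevelling`) consists of vertices
`p 0, …, p (k - 1)` and an integer height for every vertex such that `p i` has height `2 * i`, every
edge changes the height by at most `2`, every edge at some `p i` that does not lead to `p (i ± 1)`
changes the height by at most `1`, and no two edges join `p i` to `p (i + 1)`. It is *not* required
that `p i` and `p (i + 1)` are adjacent.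

* A unique shortest path of order `k` from `u` to `w` gives a levelling of order `k`
  (`Graph.IsUniqueShortestPath.exists_isLevelling`): the height of `v` is the difference of its
  distances from `u` and to `w`, up to a constant.
* Conversely, adding the missing edges between `p i` and `p (i + 1)` to a graph with a levelling of
  order `k` makes `p` a unique shortest path (`Graph.IsLevelling.exists_le_paradeNumber`): a walk of
  length at most `k - 1` from `p 0` to `p (k - 1)` has to climb by `2` in each step.
* An elementary minor operation that destroys a vertex costs at most one in the order of a levelling
  (`Graph.IsElementaryMinor.exists_isLevelling`). Indeed, one may drop any vertex `p j` and lower all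
  that lies above it by `2`; this leaves enough freedom for the heights near `p j` to give the two
  ends of a contracted edge the same height (`Graph.IsLevelling.skip`). The only other case is the
  contraction of an edge between `p i` and `p (i + 1)` (`Graph.IsLevelling.merge`).

So if `G` is a minor of `H`, then a longest unique shortest path of `H` yields a levelling of `G`,
and hence a graph `G'` on the vertices of `G`, with at most as many spectators as `H`.
-/

namespace Graph

section Spectators

variable {α β α' β' : Type*}

/-! ### Walks -/

theorem IsWalk.left_mem {G : Graph α β} {u w : α} {p : List (β × α)} (h : G.IsWalk u p w) :
    u ∈ V(G) :=
  h.mem u (by simp)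

theorem IsWalk.append {G : Graph α β} {v w : α} {q : List (β × α)} (hq : G.IsWalk v q w) :
    ∀ {p : List (β × α)} {u : α}, G.IsWalk u p v → G.IsWalk u (p ++ q) w
  | [], _, h => by obtain ⟨-, rfl⟩ := h; exact hq
  | _ :: _, _, h => ⟨h.1, hq.append h.2⟩

theorem IsWalk.right_unique {G : Graph α β} {v w : α} :
    ∀ {p : List (β × α)} {u : α}, G.IsWalk u p v → G.IsWalk u p w → v = w
  | [], _, h, h' => h.2.symm.trans h'.2
  | _ :: _, _, h, h' => h.2.right_unique h'.2

theorem IsPath.exists_suffix {G : Graph α β} {w x : α} :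
    ∀ {p : List (β × α)} {u : α}, G.IsPath u p w → x ∈ u :: p.map Prod.snd →
      ∃ q, G.IsPath x q w ∧ q.length ≤ p.length
  | [], u, h, hx => by
    obtain rfl : x = u := by simpa using hx
    exact ⟨[], h, le_rfl⟩
  | s :: p, u, h, hx => by
    rcases List.mem_cons.1 hx with rfl | hx
    · exact ⟨_, h, le_rfl⟩
    · have h' : G.IsPath s.2 p w := ⟨h.1.2, (List.nodup_cons.1 h.2).2⟩
      obtain ⟨q, hq, hl⟩ := h'.exists_suffix hx
      exact ⟨q, hq, hl.trans (by simp)⟩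

/-- A walk that is not a path can be replaced by a strictly shorter path. -/
theorem IsWalk.exists_isPath {G : Graph α β} {w : α} :
    ∀ {p : List (β × α)} {u : α}, G.IsWalk u p w →
      ∃ q, G.IsPath u q w ∧ (q.length < p.length ∨ q = p)
  | [], u, h => ⟨[], ⟨h, by simp⟩, .inr rfl⟩
  | s :: p, u, h => by
    obtain ⟨q, hq, hqp⟩ := h.2.exists_isPath
    have hlen : q.length ≤ p.length := by
      rcases hqp with h | rfl
      exacts [h.le, le_rfl]
    by_cases hu : u ∈ s.2 :: q.map Prod.snd
    · obtain ⟨r, hr, hl⟩ := hq.exists_suffix hu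
      exact ⟨r, hr, .inl (by simp; omega)⟩
    · refine ⟨s :: q, ⟨⟨h.1, hq.1⟩, List.nodup_cons.2 ⟨hu, hq.2⟩⟩, ?_⟩
      rcases hqp with h | rfl
      exacts [.inl (by simpa using h), .inr rfl]

/-- A unique shortest path is unique among all walks of at most its length. -/
theorem IsUniqueShortestPath.eq_of_isWalk {G : Graph α β} {u w : α} {p q : List (β × α)}
    (hp : G.IsUniqueShortestPath u p w) (hq : G.IsWalk u q w) (hl : q.length ≤ p.length) :
    q = p := by
  obtain ⟨r, hr, hrq⟩ := hq.exists_isPath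
  have := hp.1.2 r hr
  rcases hrq with h | rfl
  · omega
  · exact hp.2 r hr (by omega)

/-- The `i`-th vertex of the walk `p` that starts in `u`; its last vertex if there is none. -/
def walkVertex : α → List (β × α) → ℕ → α
  | u, _, 0 => u
  | u, [], _ + 1 => u
  | _, s :: p, i + 1 => walkVertex s.2 p i

theorem IsWalk.take_drop {G : Graph α β} {w : α} :
    ∀ {p : List (β × α)} {u : α} (i : ℕ), G.IsWalk u p w → i ≤ p.length →
      G.IsWalk u (p.take i) (walkVertex u p i) ∧ G.IsWalk (walkVertex u p i) (p.drop i) w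
  | p, u, 0, h, _ => by
    cases p <;> exact ⟨⟨h.left_mem, rfl⟩, h⟩
  | [], u, i + 1, _, hi => by simp at hi
  | s :: p, u, i + 1, h, hi => by
    obtain ⟨h1, h2⟩ := h.2.take_drop i (by simpa using hi)
    exact ⟨⟨h.1, h1⟩, h2⟩

theorem walkVertex_succ_of_drop_eq {e : β} {v : α} {B : List (β × α)} :
    ∀ {p : List (β × α)} {u : α} {i : ℕ}, p.drop i = (e, v) :: B → walkVertex u p (i + 1) = v
  | [], _, _, h => by simp at h
  | s :: p, u, 0, h => by
    obtain ⟨rfl, -⟩ := List.cons_eq_cons.1 h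
    cases p <;> rfl
  | s :: p, u, i + 1, h => by
    have h' : p.drop i = (e, v) :: B := by simpa using h
    exact walkVertex_succ_of_drop_eq (u := s.2) h'

/-! ### Truncated distances -/

/-- The length of a shortest walk from `a` to `b`, or `L` if it is larger than `L` or if there is no
such walk. -/
noncomputable def truncDist (G : Graph α β) (L : ℕ) (a b : α) : ℕ :=
  sInf {n | n = L ∨ ∃ q, G.IsWalk a q b ∧ q.length = n}

theorem truncDist_le {G : Graph α β} {L : ℕ} {a b : α} : G.truncDist L a b ≤ L :=
  Nat.sInf_le (.inl rfl)

theorem IsWalk.truncDist_le {G : Graph α β} {L : ℕ} {a b : α} {q : List (β × α)}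
    (hq : G.IsWalk a q b) : G.truncDist L a b ≤ q.length :=
  Nat.sInf_le (.inr ⟨q, hq, rfl⟩)

theorem exists_isWalk_of_truncDist_lt {G : Graph α β} {L : ℕ} {a b : α}
    (h : G.truncDist L a b < L) : ∃ q, G.IsWalk a q b ∧ q.length = G.truncDist L a b := by
  have := Nat.sInf_mem (s := {n | n = L ∨ ∃ q, G.IsWalk a q b ∧ q.length = n}) ⟨L, .inl rfl⟩
  rcases this with h' | h'
  · exact absurd h' h.ne
  · exact h'

theorem IsLink.truncDist_right_le {G : Graph α β} {L : ℕ} {a v v' : α} {e : β}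
    (he : G.IsLink e v v') : G.truncDist L a v' ≤ G.truncDist L a v + 1 := by
  by_cases h : G.truncDist L a v < L
  · obtain ⟨q, hq, hl⟩ := exists_isWalk_of_truncDist_lt h
    have hw : G.IsWalk v [(e, v')] v' := ⟨he, he.right_mem, rfl⟩
    simpa [hl] using (hw.append hq).truncDist_le (L := L)
  · have := truncDist_le (G := G) (L := L) (a := a) (b := v')
    omega

theorem IsLink.truncDist_left_le {G : Graph α β} {L : ℕ} {b v v' : α} {e : β}
    (he : G.IsLink e v v') : G.truncDist L v b ≤ G.truncDist L v' b + 1 := by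
  by_cases h : G.truncDist L v' b < L
  · obtain ⟨q, hq, hl⟩ := exists_isWalk_of_truncDist_lt h
    have hw : G.IsWalk v ((e, v') :: q) b := ⟨he, hq⟩
    simpa [hl] using hw.truncDist_le (L := L)
  · have := truncDist_le (G := G) (L := L) (a := v) (b := b)
    omega

/-! ### Levellings -/

/-- A levelling of order `k`: vertices `p 0, …, p (k - 1)` (the values `p i` for `i ≥ k` are
irrelevant) and a height function `h` that certify that `p` becomes a unique shortest path as soon
as the missing edges between `p i` and `p (i + 1)` are added. -/
structure IsLevelling (G : Graph α β) (h : α → ℤ) (p : ℕ → α) (k : ℕ) : Prop where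
  mem : ∀ i < k, p i ∈ V(G)
  height : ∀ i < k, h (p i) = 2 * i
  le_add_two : ∀ e u v, G.IsLink e u v → h v ≤ h u + 2
  near : ∀ e i v, i < k → G.IsLink e (p i) v →
    (h v ≤ 2 * i + 1 ∧ 2 * i ≤ h v + 1) ∨ (i + 1 < k ∧ v = p (i + 1)) ∨ ∃ j, j + 1 = i ∧ v = p j
  edge_unique : ∀ e e' i, i + 1 < k → G.IsLink e (p i) (p (i + 1)) →
    G.IsLink e' (p i) (p (i + 1)) → e = e'

theorem IsUniqueShortestPath.exists_isLevelling {G : Graph α β} {u w : α} {p : List (β × α)}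
    (hp : G.IsUniqueShortestPath u p w) : ∃ h q, G.IsLevelling h q (p.length + 1) := by
  have hw := hp.1.1.1
  -- A bound above the length of `p` makes every distance up to that length an honest one.
  set L := p.length + 1 with hL
  set c := walkVertex u p with hc
  have htd : ∀ i < L, G.IsWalk u (p.take i) (c i) ∧ G.IsWalk (c i) (p.drop i) w :=
    fun i hi => hw.take_drop i (by omega)
  have hdu : ∀ i < L, G.truncDist L u (c i) = i := by
    intro i hi
    obtain ⟨h1, h2⟩ := htd i hi
    have hle := h1.truncDist_le (L := L)
    rw [List.length_take] at hle
    by_contra hne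
    obtain ⟨q, hq, hl⟩ := exists_isWalk_of_truncDist_lt (G := G) (L := L) (a := u) (b := c i)
      (by omega)
    have := congrArg List.length
      (hp.eq_of_isWalk (h2.append hq) (by rw [List.length_append, List.length_drop]; omega))
    rw [List.length_append, List.length_drop] at this
    omega
  have hdw : ∀ i < L, G.truncDist L (c i) w = p.length - i := by
    intro i hi
    obtain ⟨h1, h2⟩ := htd i hi
    have hle := h2.truncDist_le (L := L)
    rw [List.length_drop] at hle
    by_contra hne
    obtain ⟨q, hq, hl⟩ := exists_isWalk_of_truncDist_lt (G := G) (L := L) (a := c i) (b := w)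
      (by omega)
    have := congrArg List.length
      (hp.eq_of_isWalk (hq.append h1) (by rw [List.length_append, List.length_take]; omega))
    rw [List.length_append, List.length_take] at this
    omega
  -- An edge that starts a walk from `c i` of the right length is the edge of `p` at that place.
  have hdrop : ∀ i < L, ∀ e v B, G.IsLink e (c i) v → G.IsWalk v B w → i + 1 + B.length = p.length →
      p.drop i = (e, v) :: B := by
    intro i hi e v B he hB hl
    have hwalk : G.IsWalk (c i) ((e, v) :: B) w := ⟨he, hB⟩
    have := hp.eq_of_isWalk (hwalk.append (htd i hi).1) (by simp; omega)
    nth_rw 2 [← List.take_append_drop i p] at this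
    exact (List.append_cancel_left this).symm
  refine ⟨fun v => G.truncDist L u v - G.truncDist L v w + p.length, c, ?_, ?_, ?_, ?_, ?_⟩
  · exact fun i hi => (htd i hi).2.left_mem
  · intro i hi
    simp only [hdu i hi, hdw i hi]
    omega
  · intro e a b he
    have h1 := he.truncDist_right_le (L := L) (a := u)
    have h2 := he.truncDist_left_le (L := L) (b := w)
    omega
  · intro e i v hi he
    have h1 := he.truncDist_right_le (L := L) (a := u)
    have h2 := he.truncDist_left_le (L := L) (b := w)
    have h3 := he.symm.truncDist_right_le (L := L) (a := u)
    have h4 := he.symm.truncDist_left_le (L := L) (b := w)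
    rw [hdu i hi] at h1 h3
    rw [hdw i hi] at h2 h4
    by_cases hup : G.truncDist L u v = i + 1 ∧ G.truncDist L v w + i + 1 = p.length
    · obtain ⟨B, hB, hl⟩ := exists_isWalk_of_truncDist_lt (G := G) (L := L) (a := v) (b := w)
        (by omega)
      exact .inr (.inl ⟨by omega, (walkVertex_succ_of_drop_eq
        (hdrop i hi e v B he hB (by omega))).symm⟩)
    by_cases hdn : G.truncDist L u v + 1 = i ∧ G.truncDist L v w + i = p.length + 1
    · obtain ⟨A, hA, hl⟩ := exists_isWalk_of_truncDist_lt (G := G) (L := L) (a := u) (b := v)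
        (by omega)
      have hwalk : G.IsWalk v ((e, c i) :: p.drop i) w := ⟨he.symm, (htd i hi).2⟩
      have heq := hp.eq_of_isWalk (hwalk.append hA) (by simp; omega)
      have hA' : A = p.take A.length := by
        conv_rhs => rw [← heq]
        simp
      have h5 := (htd A.length (by omega)).1
      rw [← hA'] at h5
      exact .inr (.inr ⟨A.length, by omega, hA.right_unique h5⟩)
    left
    omega
  · intro e e' i hi he he'
    have hB := (htd (i + 1) hi).2
    have h1 := hdrop i (by omega) e _ _ he hB (by simp; omega)
    have h2 := hdrop i (by omega) e' _ _ he' hB (by simp; omega)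
    rw [h1] at h2
    simpa using h2

namespace IsLevelling

variable {G : Graph α β} {h : α → ℤ} {p : ℕ → α} {k : ℕ}

theorem index_eq (L : G.IsLevelling h p k) {i j : ℕ} (hi : i < k) (hj : j < k) (hij : p i = p j) :
    i = j := by
  have h1 := L.height i hi
  rw [hij, L.height j hj] at h1
  omega

/-- The heights may be clamped to the range of the heights of the vertices `p i`. -/
theorem exists_bounded (L : G.IsLevelling h p k) (hk : 0 < k) :
    ∃ h', G.IsLevelling h' p k ∧ ∀ v, 0 ≤ h' v ∧ h' v ≤ 2 * k - 2 := by
  refine ⟨fun v => max 0 (min (h v) (2 * k - 2)), ⟨L.mem, ?_, ?_, ?_, L.edge_unique⟩, ?_⟩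
  · intro i hi
    have := L.height i hi
    omega
  · intro e u v he
    have := L.le_add_two e u v he
    omega
  · intro e i v hi he
    rcases L.near e i v hi he with h1 | h1
    · left
      omega
    · exact .inr h1
  · intro v
    dsimp only
    omega

/-- The vertex `p j` may be dropped from a levelling, if the heights above it are lowered by `2`. The
heights next to `p j` can be chosen with some freedom. -/
theorem skip (L : G.IsLevelling h p k) {j : ℕ} (hj : j < k) {h' : α → ℤ}
    (hlow : ∀ v, h v ≤ 2 * j - 2 → h' v = h v) (hhigh : ∀ v, 2 * j + 1 ≤ h v → h' v = h v - 2)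
    (hmid : ∀ v, 2 * j - 1 ≤ h v → h v ≤ 2 * j → 2 * (j : ℤ) - 2 ≤ h' v ∧ h' v ≤ 2 * j - 1)
    (hpj : h' (p j) = 2 * j - 1) :
    G.IsLevelling h' (fun i => if i < j then p i else p (i + 1)) (k - 1) := by
  have hcase : ∀ v, (h v ≤ 2 * j - 2 ∧ h' v = h v) ∨ (2 * j + 1 ≤ h v ∧ h' v = h v - 2) ∨
      (2 * j - 1 ≤ h v ∧ h v ≤ 2 * j ∧ 2 * (j : ℤ) - 2 ≤ h' v ∧ h' v ≤ 2 * j - 1) := by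
    intro v
    by_cases h1 : h v ≤ 2 * j - 2
    · exact .inl ⟨h1, hlow v h1⟩
    by_cases h2 : 2 * j + 1 ≤ h v
    · exact .inr (.inl ⟨h2, hhigh v h2⟩)
    · exact .inr (.inr ⟨by omega, by omega, hmid v (by omega) (by omega)⟩)
  refine ⟨?_, ?_, ?_, ?_, ?_⟩
  · intro i hi
    split_ifs
    exacts [L.mem _ (by omega), L.mem _ (by omega)]
  · intro i hi
    split_ifs with hij
    · have := L.height i (by omega)
      rw [hlow _ (by omega), this]
    · have := L.height (i + 1) (by omega)
      rw [hhigh _ (by omega), this]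
      push_cast
      ring
  · intro e u v he
    have h1 := L.le_add_two e u v he
    have h2 := hcase u
    have h3 := hcase v
    omega
  · intro e i v hi he
    have h3 := hcase v
    split_ifs at he with hij
    · rcases L.near e i v (by omega) he with h1 | ⟨h1, rfl⟩ | ⟨l, rfl, rfl⟩
      · left
        omega
      · by_cases hij' : i + 1 < j
        · exact .inr (.inl ⟨by omega, by simp [hij']⟩)
        · obtain rfl : i + 1 = j := by omega
          left
          rw [hpj]
          omega
      · exact .inr (.inr ⟨l, rfl, by rw [if_pos (by omega)]⟩)
    · rcases L.near e (i + 1) v (by omega) he with h1 | ⟨h1, rfl⟩ | ⟨l, hl, rfl⟩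
      · left
        omega
      · exact .inr (.inl ⟨by omega, by rw [if_neg (by omega)]⟩)
      · obtain rfl : l = i := by omega
        by_cases hij' : l = j
        · subst hij'
          left
          rw [hpj]
          omega
        · exact .inr (.inr ⟨l - 1, by omega, by
            rw [if_neg (by omega), Nat.sub_add_cancel (by omega)]⟩)
  · intro e e' i hi he he'
    by_cases h1 : i + 1 < j
    · rw [if_pos (by omega), if_pos h1] at he he'
      exact L.edge_unique e e' i (by omega) he he'
    by_cases h2 : i < j
    · -- Here `p i` and `p (i + 2)` are two apart, hence not adjacent.
      rw [if_pos h2, if_neg h1] at he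
      have := L.le_add_two _ _ _ he
      rw [L.height _ (by omega), L.height _ (by omega)] at this
      omega
    · rw [if_neg h2, if_neg h1] at he he'
      exact L.edge_unique e e' (i + 1) (by omega) he he'

/-- A levelling descends along a map of graphs that preserves the heights and identifies no `p i`
with another vertex. -/
theorem of_map (L : G.IsLevelling h p k) {K : Graph α β} {π : α → α}
    (hmem : ∀ i < k, p i ∈ V(K))
    (hlink : ∀ e u v, K.IsLink e u v → ∃ u₀ v₀, G.IsLink e u₀ v₀ ∧ π u₀ = u ∧ π v₀ = v)
    (hh : ∀ v, h (π v) = h v) (hπ : ∀ i < k, ∀ v, π v = p i ↔ v = p i) :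
    K.IsLevelling h p k := by
  refine ⟨hmem, L.height, ?_, ?_, ?_⟩
  · intro e u v he
    obtain ⟨u, v, he₀, rfl, rfl⟩ := hlink e u v he
    simpa [hh] using L.le_add_two e u v he₀
  · intro e i v hi he
    obtain ⟨u, v, he, hu, rfl⟩ := hlink e _ v he
    rw [hπ i hi] at hu
    subst hu
    rw [hh]
    rcases L.near e i v hi he with h1 | ⟨h1, h2⟩ | ⟨l, rfl, h2⟩
    · exact .inl h1
    · exact .inr (.inl ⟨h1, (hπ _ h1 _).2 h2⟩)
    · exact .inr (.inr ⟨l, rfl, (hπ _ (by omega) _).2 h2⟩)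
  · intro e e' i hi he he'
    obtain ⟨u, v, he, hu, hv⟩ := hlink e _ _ he
    obtain ⟨u', v', he', hu', hv'⟩ := hlink e' _ _ he'
    rw [hπ i (by omega)] at hu hu'
    rw [hπ _ hi] at hv hv'
    subst hu hv hu' hv'
    exact L.edge_unique e e' i hi he he'

theorem anti (L : G.IsLevelling h p k) {K : Graph α β} (hK : K ≤ G) (hmem : ∀ i < k, p i ∈ V(K)) :
    K.IsLevelling h p k :=
  L.of_map (π := id) hmem (fun _ u v he => ⟨u, v, he.mono hK, rfl, rfl⟩) (fun _ => rfl)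
    (fun _ _ _ => Iff.rfl)

/-- The vertices `p i` and `p (i + 1)` may be identified, if the heights from `p (i + 1)` on are
lowered by `2`. -/
theorem merge (L : G.IsLevelling h p k) {i : ℕ} (hi : i + 1 < k) {K : Graph α β} {π : α → α}
    (hmem : ∀ v ∈ V(G), π v ∈ V(K))
    (hlink : ∀ e u v, K.IsLink e u v → ∃ u₀ v₀, G.IsLink e u₀ v₀ ∧ π u₀ = u ∧ π v₀ = v)
    (hπi : π (p i) = π (p (i + 1)))
    (hπ : ∀ a b, π a = π b → a = b ∨ (a = p i ∧ b = p (i + 1)) ∨ (a = p (i + 1) ∧ b = p i))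
    {h' : α → ℤ} (hh : ∀ v, h' (π v) = if h v ≤ 2 * i then h v else if h v = 2 * i + 1 then 2 * i
      else h v - 2) :
    K.IsLevelling h' (fun m => π (p (if m < i then m else m + 1))) (k - 1) := by
  have hcase : ∀ v, (h v ≤ 2 * i ∧ h' (π v) = h v) ∨ (h v = 2 * i + 1 ∧ h' (π v) = 2 * i) ∨
      (2 * i + 2 ≤ h v ∧ h' (π v) = h v - 2) := by
    intro v
    rw [hh v]
    split_ifs <;> omega
  -- The preimages of the `m`-th vertex.
  have hpre : ∀ m < k - 1, ∀ v, π v = π (p (if m < i then m else m + 1)) →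
      (m < i ∧ v = p m) ∨ (m = i ∧ (v = p i ∨ v = p (i + 1))) ∨ (i < m ∧ v = p (m + 1)) := by
    intro m hm v hv
    rcases lt_trichotomy m i with hmi | rfl | hmi
    · rw [if_pos hmi] at hv
      rcases hπ _ _ hv with h1 | ⟨-, h1⟩ | ⟨-, h1⟩
      · exact .inl ⟨hmi, h1⟩
      · have := L.index_eq (by omega) (by omega) h1
        omega
      · have := L.index_eq (by omega) (by omega) h1
        omega
    · rw [if_neg (lt_irrefl _)] at hv
      rcases hπ _ _ hv with h1 | ⟨h1, -⟩ | ⟨h1, -⟩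
      exacts [.inr (.inl ⟨rfl, .inr h1⟩), .inr (.inl ⟨rfl, .inl h1⟩),
        .inr (.inl ⟨rfl, .inr h1⟩)]
    · rw [if_neg hmi.not_gt] at hv
      rcases hπ _ _ hv with h1 | ⟨-, h1⟩ | ⟨-, h1⟩
      · exact .inr (.inr ⟨hmi, h1⟩)
      · have := L.index_eq (by omega) (by omega) h1
        omega
      · have := L.index_eq (by omega) (by omega) h1
        omega
  refine ⟨?_, ?_, ?_, ?_, ?_⟩
  · intro m hm
    refine hmem _ (L.mem _ ?_)
    split_ifs <;> omega
  · intro m hm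
    have h1 := hcase (p (if m < i then m else m + 1))
    split_ifs at h1 ⊢ with hmi
    · rw [L.height m (by omega)] at h1
      omega
    · rw [L.height (m + 1) (by omega)] at h1
      push_cast at h1
      omega
  · intro e u v he
    obtain ⟨u, v, he₀, rfl, rfl⟩ := hlink e u v he
    have h1 := L.le_add_two e u v he₀
    have h2 := hcase u
    have h3 := hcase v
    omega
  · intro e m v hm he
    obtain ⟨u, v, he, hu, rfl⟩ := hlink e _ v he
    have h3 := hcase v
    rcases hpre m hm u hu with ⟨hmi, rfl⟩ | ⟨rfl, rfl | rfl⟩ | ⟨hmi, rfl⟩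
    · rcases L.near e m v (by omega) he with h1 | ⟨h1, rfl⟩ | ⟨l, rfl, rfl⟩
      · left
        omega
      · refine .inr (.inl ⟨by omega, ?_⟩)
        split_ifs with hmi'
        · rfl
        · obtain rfl : m + 1 = i := by omega
          exact hπi
      · exact .inr (.inr ⟨l, rfl, by rw [if_pos (by omega)]⟩)
    · rcases L.near e m v (by omega) he with h1 | ⟨h1, rfl⟩ | ⟨l, rfl, rfl⟩
      · left
        omega
      · left
        rw [L.height _ hi] at h3
        push_cast at h3
        omega
      · exact .inr (.inr ⟨l, rfl, by rw [if_pos (by omega)]⟩)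
    · rcases L.near e (m + 1) v (by omega) he with h1 | ⟨h1, rfl⟩ | ⟨l, hl, rfl⟩
      · left
        push_cast at h1
        omega
      · exact .inr (.inl ⟨by omega, by rw [if_neg (by omega)]⟩)
      · obtain rfl : l = m := by omega
        left
        rw [L.height _ (by omega)] at h3
        omega
    · rcases L.near e (m + 1) v (by omega) he with h1 | ⟨h1, rfl⟩ | ⟨l, hl, rfl⟩
      · left
        push_cast at h1
        omega
      · exact .inr (.inl ⟨by omega, by rw [if_neg (by omega)]⟩)
      · obtain rfl : l = m := by omega
        exact .inr (.inr ⟨l - 1, by omega, by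
          rw [if_neg (by omega), Nat.sub_add_cancel (by omega)]⟩)
  · intro e e' m hm he he'
    -- An edge between the images of consecutive vertices comes from one fixed consecutive pair,
    -- since vertices of the levelling that are two apart are not adjacent.
    have key : ∀ e, K.IsLink e (π (p (if m < i then m else m + 1)))
        (π (p (if m + 1 < i then m + 1 else m + 1 + 1))) →
        G.IsLink e (p (if m < i then m else m + 1)) (p ((if m < i then m else m + 1) + 1)) := by
      intro e he
      obtain ⟨u, v, he, hu, hv⟩ := hlink e _ _ he
      have h1 := L.le_add_two _ _ _ he
      have hu' := hpre m (by omega) u hu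
      have hv' := hpre (m + 1) hm v hv
      have hpi := L.height i (by omega)
      have hpi' := L.height (i + 1) hi
      push_cast at hpi'
      rcases hu' with ⟨hmi, rfl⟩ | ⟨rfl, hu'⟩ | ⟨hmi, rfl⟩
      · rw [if_pos hmi]
        rcases hv' with ⟨hmi', rfl⟩ | ⟨hmi', rfl | rfl⟩ | ⟨hmi', rfl⟩
        · exact he
        · rwa [hmi']
        · have := L.height m (by omega)
          omega
        · omega
      · rw [if_neg (lt_irrefl _)]
        rcases hv' with ⟨hmi', rfl⟩ | ⟨hmi', -⟩ | ⟨hmi', rfl⟩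
        · omega
        · omega
        · rcases hu' with rfl | rfl
          · have := L.height (m + 1 + 1) (by omega)
            push_cast at this
            omega
          · exact he
      · rw [if_neg hmi.not_gt]
        rcases hv' with ⟨hmi', rfl⟩ | ⟨hmi', -⟩ | ⟨hmi', rfl⟩
        · omega
        · omega
        · exact he
    refine L.edge_unique e e' _ ?_ (key e he) (key e' he')
    split_ifs <;> omega

theorem of_iso (L : G.IsLevelling h p k) {K : Graph α' β'} (hne : V(K).Nonempty) (φ : K.Iso G) :
    ∃ h' p', K.IsLevelling h' p' k := by
  classical
  obtain ⟨x₀, -⟩ := hne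
  have hlink : ∀ {e x y} (he : K.IsLink e x y), G.IsLink (φ.edgeEquiv ⟨e, he.edge_mem⟩)
      (φ.vertexEquiv ⟨x, he.left_mem⟩) (φ.vertexEquiv ⟨y, he.right_mem⟩) :=
    fun he => (φ.isLink_iff ⟨_, he.edge_mem⟩ ⟨_, he.left_mem⟩ ⟨_, he.right_mem⟩).1 he
  set h' : α' → ℤ := fun v => if hv : v ∈ V(K) then h (φ.vertexEquiv ⟨v, hv⟩) else 0
  set p' : ℕ → α' := fun i => if hi : p i ∈ V(G) then φ.vertexEquiv.symm ⟨p i, hi⟩ else x₀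
  have hh : ∀ v (hv : v ∈ V(K)), h' v = h (φ.vertexEquiv ⟨v, hv⟩) := fun v hv => dif_pos hv
  have hp : ∀ i < k, ∀ v (hv : v ∈ V(K)), v = p' i ↔ (φ.vertexEquiv ⟨v, hv⟩ : α) = p i := by
    intro i hi v hv
    simp only [p', dif_pos (L.mem i hi)]
    constructor
    · rintro rfl
      simp
    · intro h1
      have h2 : φ.vertexEquiv ⟨v, hv⟩ = ⟨p i, L.mem i hi⟩ := Subtype.ext h1
      rw [← h2]
      simp
  have hmem : ∀ i < k, p' i ∈ V(K) := by
    intro i hi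
    simp only [p', dif_pos (L.mem i hi)]
    exact Subtype.coe_prop _
  refine ⟨h', p', hmem, ?_, ?_, ?_, ?_⟩
  · intro i hi
    rw [hh _ (hmem i hi), (hp i hi _ (hmem i hi)).1 rfl, L.height i hi]
  · intro e u v he
    rw [hh _ he.left_mem, hh _ he.right_mem]
    exact L.le_add_two _ _ _ (hlink he)
  · intro e i v hi he
    have he' := hlink he
    rw [(hp i hi _ he.left_mem).1 rfl] at he'
    rw [hh _ he.right_mem]
    rcases L.near _ i _ hi he' with h1 | ⟨h1, h2⟩ | ⟨l, rfl, h2⟩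
    · exact .inl h1
    · exact .inr (.inl ⟨h1, (hp _ h1 _ he.right_mem).2 h2⟩)
    · exact .inr (.inr ⟨l, rfl, (hp _ (by omega) _ he.right_mem).2 h2⟩)
  · intro e e' i hi he he'
    have h1 := hlink he
    have h2 := hlink he'
    rw [(hp i (by omega) _ he.left_mem).1 rfl, (hp _ hi _ he.right_mem).1 rfl] at h1 h2
    have h3 := L.edge_unique _ _ i hi h1 h2
    simpa using φ.edgeEquiv.injective (Subtype.ext h3)

end IsLevelling

/-! ### Levellings of minors -/

open Classical in
/-- Some vertex of a levelling can be dropped such that the ends of a given edge get the same height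
and lie outside the levelling, unless both ends belong to the levelling. -/
theorem IsLevelling.exists_skip {G : Graph α β} {h : α → ℤ} {p : ℕ → α} {k : ℕ}
    (L : G.IsLevelling h p k) (hk : 0 < k) {e : β} {x y : α} (he : G.IsLink e x y)
    (hxy : (∀ i < k, x ≠ p i) ∨ ∀ i < k, y ≠ p i) :
    ∃ h' p', G.IsLevelling h' p' (k - 1) ∧ h' x = h' y ∧
      ∀ i < k - 1, x ≠ p' i ∧ y ≠ p' i := by
  have hcase : ∀ x y, G.IsLink e x y → (∃ j < k, x = p j) → (∀ i < k, y ≠ p i) →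
      ∃ h' p', G.IsLevelling h' p' (k - 1) ∧ h' x = h' y ∧ ∀ i < k - 1, x ≠ p' i ∧ y ≠ p' i := by
    rintro _ y he ⟨j, hj, rfl⟩ hy
    have hpj := L.height j hj
    have hyj : h y ≤ 2 * j + 1 ∧ 2 * j ≤ h y + 1 := by
      rcases L.near e j y hj he with h1 | ⟨h1, h2⟩ | ⟨l, rfl, h2⟩
      exacts [h1, absurd h2 (hy _ h1), absurd h2 (hy _ (by omega))]
    refine ⟨fun v => if h v ≤ 2 * j - 1 then h v else if h v = 2 * j then 2 * j - 1 else h v - 2, _,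
      L.skip hj ?_ ?_ ?_ ?_, ?_, ?_⟩
    · intro v hv
      split_ifs <;> omega
    · intro v hv
      split_ifs <;> omega
    · intro v hv hv'
      split_ifs <;> omega
    · split_ifs <;> omega
    · dsimp only
      split_ifs <;> omega
    · intro i hi
      split_ifs with hij
      · refine ⟨fun h1 => ?_, hy _ (by omega)⟩
        have := L.index_eq hj (by omega) h1
        omega
      · refine ⟨fun h1 => ?_, hy _ (by omega)⟩
        have := L.index_eq hj (by omega) h1
        omega
  by_cases hx : ∃ j < k, x = p j
  · rcases hxy with h1 | h1
    · obtain ⟨j, hj, h2⟩ := hx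
      exact absurd h2 (h1 j hj)
    · exact hcase x y he hx h1
  by_cases hy : ∃ j < k, y = p j
  · push Not at hx
    obtain ⟨h', p', h1, h2, h3⟩ := hcase y x he.symm hy hx
    exact ⟨h', p', h1, h2.symm, fun i hi => (h3 i hi).symm⟩
  push Not at hx hy
  obtain ⟨h', L', hb⟩ := L.exists_bounded hk
  have h1 := L'.le_add_two _ _ _ he
  have h2 := L'.le_add_two _ _ _ he.symm
  have hbx := hb x
  have hby := hb y
  have hne : ∀ j, ∀ i < k - 1, x ≠ (if i < j then p i else p (i + 1)) ∧
      y ≠ (if i < j then p i else p (i + 1)) := by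
    intro j i hi
    split_ifs
    exacts [⟨hx _ (by omega), hy _ (by omega)⟩, ⟨hx _ (by omega), hy _ (by omega)⟩]
  -- The two heights differ by at most `2`, so they lie between `2 * j - 1` and `2 * j + 1` or between
  -- `2 * j - 2` and `2 * j` for some `j`. Dropping `p j` allows all vertices outside the levelling
  -- with heights in such a range to be given the same height.
  obtain ⟨j, hj, hj'⟩ : ∃ j < k, (2 * j - 1 ≤ h' x ∧ h' x ≤ 2 * j + 1 ∧ 2 * j - 1 ≤ h' y ∧
      h' y ≤ 2 * (j : ℤ) + 1) ∨ (2 * j - 2 ≤ h' x ∧ h' x ≤ 2 * j ∧ 2 * j - 2 ≤ h' y ∧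
      h' y ≤ 2 * (j : ℤ)) := by
    by_cases hlt : h' x = h' y + 2 ∨ h' y = h' x + 2
    · exact ⟨(max (h' x) (h' y) / 2).toNat, by omega, by omega⟩
    · exact ⟨((min (h' x) (h' y) + 1) / 2).toNat, by omega, by omega⟩
  have hpj := L'.height j hj
  rcases hj' with hj' | hj'
  · refine ⟨fun v => if h' v ≤ 2 * j - 1 then h' v else if h' v = 2 * j then 2 * j - 1
      else h' v - 2, _, L'.skip hj ?_ ?_ ?_ ?_, ?_, hne j⟩
    · intro v hv
      split_ifs <;> omega
    · intro v hv
      split_ifs <;> omega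
    · intro v hv hv'
      split_ifs <;> omega
    · split_ifs <;> omega
    · dsimp only
      split_ifs <;> omega
  · refine ⟨fun v => if v = p j then 2 * j - 1 else if h' v ≤ 2 * j - 2 then h' v
      else if h' v = 2 * j - 1 then 2 * j - 2 else h' v - 2, _, L'.skip hj ?_ ?_ ?_ ?_, ?_, hne j⟩
    · intro v hv
      have : v ≠ p j := by rintro rfl; omega
      simp only [this, if_false]
      split_ifs
      omega
    · intro v hv
      have : v ≠ p j := by rintro rfl; omega
      simp only [this, if_false]
      split_ifs <;> omega
    · intro v hv hv'
      split_ifs <;> omega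
    · simp
    · simp only [hx j hj, hy j hj, if_false]
      split_ifs <;> omega

theorem IsElementaryMinor.vertexSet_finite {H K : Graph α β} (hHK : H.IsElementaryMinor K)
    (hfin : V(H).Finite) : V(K).Finite := by
  cases hHK with
  | deleteVertex x hx hiso => rw [vertexSet_deleteVerts]; exact hfin.sdiff
  | deleteEdge e he => exact hfin
  | contract e x y he hpar => exact hfin.image _

/-- An elementary minor operation lowers the largest order of a levelling by at most the number of
vertices that it destroys. -/
theorem IsElementaryMinor.exists_isLevelling {H K : Graph α β} (hHK : H.IsElementaryMinor K)
    (hfin : V(H).Finite) {h : α → ℤ} {p : ℕ → α} {k : ℕ} (L : H.IsLevelling h p k) :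
    ∃ h' p' k', K.IsLevelling h' p' k' ∧ V(K).ncard + k ≤ V(H).ncard + k' := by
  classical
  cases hHK with
  | deleteVertex x hx hiso =>
    have hcard : V(H.deleteVerts {x}).ncard + 1 = V(H).ncard := by
      rw [vertexSet_deleteVerts]
      exact Set.ncard_sdiff_singleton_add_one hx hfin
    by_cases hxp : ∃ j < k, x = p j
    · obtain ⟨j, hj, rfl⟩ := hxp
      have hpj := L.height j hj
      have L' := L.skip hj
        (h' := fun v => if h v ≤ 2 * j - 1 then h v else if h v = 2 * j then 2 * j - 1 else h v - 2)
        (fun v hv => by split_ifs <;> omega)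
        (fun v hv => by split_ifs <;> omega)
        (fun v hv hv' => by split_ifs <;> omega)
        (by split_ifs <;> omega)
      refine ⟨_, _, _, L'.anti deleteVerts_le ?_, by omega⟩
      intro i hi
      rw [vertexSet_deleteVerts]
      refine ⟨L'.mem i hi, fun h1 => ?_⟩
      have h1 : (if i < j then p i else p (i + 1)) = p j := h1
      split_ifs at h1 with hij
      · have := L.index_eq (by omega) hj h1
        omega
      · have := L.index_eq (by omega) hj h1
        omega
    · push Not at hxp
      refine ⟨h, p, k, L.anti deleteVerts_le ?_, by omega⟩
      intro i hi
      rw [vertexSet_deleteVerts]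
      exact ⟨L.mem i hi, fun h1 => hxp i hi (Eq.symm h1)⟩
  | deleteEdge e he => exact ⟨h, p, k, L.anti deleteEdges_le L.mem, le_rfl⟩
  | contract e x y he hpar =>
    set π : α → α := fun z => if z = y then x else z with hπ
    have hlink : ∀ f u v, (H.contractEdge e x y).IsLink f u v →
        ∃ u₀ v₀, H.IsLink f u₀ v₀ ∧ π u₀ = u ∧ π v₀ = v := by
      rintro f u v ⟨u₀, v₀, h1, h2, h3⟩
      exact ⟨u₀, v₀, h1.mono deleteEdges_le, h2, h3⟩
    have hmem : ∀ v ∈ V(H), π v ∈ V(H.contractEdge e x y) := fun v hv => ⟨v, hv, rfl⟩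
    have hle : V(H.contractEdge e x y).ncard ≤ V(H).ncard := Set.ncard_image_le hfin
    by_cases hne : x = y
    · -- Contracting a loop amounts to deleting it.
      subst hne
      have hid : ∀ v, π v = v := by
        intro v
        simp only [hπ]
        split_ifs with h1
        exacts [h1.symm, rfl]
      refine ⟨h, p, k, L.of_map (π := π) ?_ hlink ?_ ?_, by omega⟩
      · intro i hi
        rw [← hid (p i)]
        exact hmem _ (L.mem i hi)
      · intro v
        rw [hid]
      · intro i hi v
        rw [hid]
    have hcard : V(H.contractEdge e x y).ncard + 1 ≤ V(H).ncard := by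
      have hsub : V(H.contractEdge e x y) ⊆ V(H) \ {y} := by
        rintro _ ⟨v, hv, rfl⟩
        dsimp only
        split_ifs with h1
        exacts [⟨he.left_mem, hne⟩, ⟨hv, h1⟩]
      have := Set.ncard_le_ncard hsub hfin.sdiff
      have := Set.ncard_sdiff_singleton_add_one he.right_mem hfin
      omega
    rcases Nat.eq_zero_or_pos k with rfl | hk
    · refine ⟨0, p, 0, ⟨?_, ?_, ?_, ?_, ?_⟩, by omega⟩ <;> intros <;> simp_all
    by_cases hxy : (∀ i < k, x ≠ p i) ∨ ∀ i < k, y ≠ p i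
    · obtain ⟨h', p', L', hh, hne'⟩ := L.exists_skip hk he hxy
      refine ⟨h', p', k - 1, L'.of_map (π := π) ?_ hlink ?_ ?_, by omega⟩
      · intro i hi
        have := hmem _ (L'.mem i hi)
        simpa only [hπ, if_neg (hne' i hi).2.symm] using this
      · intro v
        simp only [hπ]
        split_ifs with h1
        · rw [h1, hh]
        · rfl
      · intro i hi v
        simp only [hπ]
        split_ifs with h1
        · exact ⟨fun h2 => absurd h2 (hne' i hi).1,
            fun h2 => absurd (h1.symm.trans h2) (hne' i hi).2⟩
        · rfl
    · push Not at hxy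
      obtain ⟨⟨a, ha, hxa⟩, b, hb, hyb⟩ := hxy
      have hmerge : ∀ i, i + 1 < k → (x = p i ∧ y = p (i + 1) ∨ x = p (i + 1) ∧ y = p i) →
          ∃ h' p', (H.contractEdge e x y).IsLevelling h' p' (k - 1) := by
        intro i hi hor
        have hpi := L.height i (by omega)
        have hpi' := L.height (i + 1) hi
        push_cast at hpi'
        refine ⟨fun v => if h v ≤ 2 * i then h v else if h v = 2 * i + 1 then 2 * i else h v - 2, _,
          L.merge hi (π := π) hmem hlink ?_ ?_ ?_⟩
        · rcases hor with ⟨h1, h2⟩ | ⟨h1, h2⟩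
          · simp [hπ, ← h1, ← h2]
          · simp [hπ, ← h1, ← h2]
        · intro c d hcd
          simp only [hπ] at hcd
          rcases hor with ⟨rfl, rfl⟩ | ⟨rfl, rfl⟩ <;> split_ifs at hcd <;> simp_all
        · intro v
          simp only [hπ]
          by_cases hv : v = y
          · subst hv
            rcases hor with ⟨rfl, rfl⟩ | ⟨rfl, rfl⟩
            all_goals
              simp only [if_true, hpi, hpi']
              split_ifs <;> omega
          · simp only [if_neg hv]
      subst hxa hyb
      have hab : a ≠ b := fun h1 => hne (by rw [h1])
      have h1 := L.le_add_two _ _ _ he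
      have h2 := L.le_add_two _ _ _ he.symm
      rw [L.height a ha, L.height b hb] at h1 h2
      obtain hab' | hab' : b = a + 1 ∨ a = b + 1 := by omega
      · obtain ⟨h', p', L'⟩ := hmerge a (by omega) (.inl ⟨rfl, by rw [hab']⟩)
        exact ⟨h', p', _, L', by omega⟩
      · obtain ⟨h', p', L'⟩ := hmerge b (by omega) (.inr ⟨by rw [hab'], rfl⟩)
        exact ⟨h', p', _, L', by omega⟩

theorem exists_isLevelling_of_reflTransGen {H K : Graph α β}
    (hHK : Relation.ReflTransGen IsElementaryMinor H K) (hfin : V(H).Finite) {h : α → ℤ}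
    {p : ℕ → α} {k : ℕ} (L : H.IsLevelling h p k) :
    ∃ h' p' k', K.IsLevelling h' p' k' ∧ V(K).ncard + k ≤ V(H).ncard + k' := by
  suffices V(K).Finite ∧ ∃ h' p' k', K.IsLevelling h' p' k' ∧ V(K).ncard + k ≤ V(H).ncard + k' from
    this.2
  induction hHK with
  | refl => exact ⟨hfin, h, p, k, L, le_rfl⟩
  | tail _ hstep ih =>
    obtain ⟨hfin', h₁, p₁, k₁, L₁, hle⟩ := ih
    obtain ⟨h₂, p₂, k₂, L₂, hle'⟩ := hstep.exists_isLevelling hfin' L₁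
    exact ⟨hstep.vertexSet_finite hfin', h₂, p₂, k₂, L₂, by omega⟩

theorem Iso.ncard_vertexSet_eq {G : Graph α β} {H : Graph α' β'} (φ : G.Iso H) :
    V(G).ncard = V(H).ncard := by
  rw [← Nat.card_coe_set_eq, ← Nat.card_coe_set_eq]
  exact Nat.card_congr φ.vertexEquiv

/-! ### From levellings to unique shortest paths -/

/-- If the vertices of a levelling are joined consecutively, by the edges `ε i`, then the path
through them is a unique shortest path. -/
theorem IsLevelling.le_paradeNumber {G : Graph α β} (hG : G.IsFiniteMultigraph) {h : α → ℤ}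
    {p : ℕ → α} {k : ℕ} (L : G.IsLevelling h p k) {ε : ℕ → β}
    (hε : ∀ i, i + 1 < k → G.IsLink (ε i) (p i) (p (i + 1))) : k ≤ G.paradeNumber := by
  rcases k with _ | n
  · exact Nat.zero_le _
  have hlip : ∀ (q : List (β × α)) (u w : α), G.IsWalk u q w → h w ≤ h u + 2 * q.length := by
    intro q
    induction q with
    | nil =>
      rintro u w ⟨-, rfl⟩
      simp
    | cons s q ih =>
      rintro u w ⟨h1, h2⟩
      have := ih _ _ h2
      have := L.le_add_two _ _ _ h1
      simp only [List.length_cons]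
      push_cast
      omega
  let P : ℕ → ℕ → List (β × α) := fun i m => (List.range' i m).map fun j => (ε j, p (j + 1))
  have hP : ∀ i m, P i (m + 1) = (ε i, p (i + 1)) :: P (i + 1) m := by
    intro i m
    simp [P, List.range'_succ]
  have hwalk : ∀ m i, i + m < n + 1 → G.IsWalk (p i) (P i m) (p (i + m)) := by
    intro m
    induction m with
    | zero => exact fun i hi => ⟨L.mem i hi, rfl⟩
    | succ m ih =>
      intro i hi
      rw [hP]
      refine ⟨hε i (by omega), ?_⟩
      have := ih (i + 1) (by omega)
      rwa [Nat.add_right_comm] at this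
  have huniq : ∀ (q : List (β × α)) (i : ℕ) (w : α), i < n + 1 → G.IsWalk (p i) q w →
      2 * (i : ℤ) + 2 * q.length ≤ h w → q = P i q.length := by
    intro q
    induction q with
    | nil => exact fun i w _ _ _ => rfl
    | cons s q ih =>
      rintro i w hi ⟨h1, h2⟩ hw
      simp only [List.length_cons] at hw ⊢
      push_cast at hw
      have h3 := hlip _ _ _ h2
      rcases L.near _ i _ hi h1 with h4 | ⟨h4, h5⟩ | ⟨l, rfl, h5⟩
      · omega
      · rw [h5] at h1 h2
        have h6 := ih (i + 1) w h4 h2 (by push_cast; omega)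
        rw [hP, ← h6, ← L.edge_unique _ _ i h4 h1 (hε i h4), ← h5]
      · rw [h5, L.height l (by omega)] at h3
        push_cast at hw
        omega
  have hlen : (P 0 n).length = n := by simp [P]
  have hw := hwalk n 0 (by omega)
  rw [Nat.zero_add] at hw
  have hp0 := L.height 0 (by omega)
  have hpn := L.height n (by omega)
  have hpath : G.IsPath (p 0) (P 0 n) (p n) := by
    obtain ⟨q, hq, hq' | rfl⟩ := hw.exists_isPath
    · have := hlip _ _ _ hq.1
      push_cast at hp0
      omega
    · exact hq
  refine (isGreatest_paradeNumber hG).2 ⟨p 0, P 0 n, p n, ⟨⟨hpath, ?_⟩, ?_⟩, by rw [hlen]⟩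
  · intro q hq
    have := hlip _ _ _ hq.1
    push_cast at hp0
    omega
  · intro q hq hl
    rw [hlen] at hl
    have := huniq q 0 (p n) (by omega) hq.1 (by rw [hpn, hl]; simp)
    rw [this, hl]

/-- The graph `G` with additional edges `Sum.inr c` between `p i` and `p (i + 1)`, where `i = label c`,
whenever `i + 1 < k` and `G` has no such edge. The map `label` is there to allow a copy of `ℕ` in any
universe as `γ`. -/
def addSteps {γ : Type*} (G : Graph α β) (p : ℕ → α) (k : ℕ) (hp : ∀ i < k, p i ∈ V(G))
    (label : γ → ℕ) : Graph α (β ⊕ γ) where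
  vertexSet := V(G)
  IsLink s x y := match s with
    | .inl e => G.IsLink e x y
    | .inr c => label c + 1 < k ∧ ¬ G.Adj (p (label c)) (p (label c + 1)) ∧
      (x = p (label c) ∧ y = p (label c + 1) ∨ x = p (label c + 1) ∧ y = p (label c))
  isLink_symm := by
    rintro (e | c) -
    · exact ⟨fun _ _ h => h.symm⟩
    · exact ⟨fun _ _ ⟨h1, h2, h3⟩ => ⟨h1, h2, by tauto⟩⟩
  eq_or_eq_of_isLink_of_isLink := by
    rintro (e | c) x y z w h h'
    · exact h.left_eq_or_eq h'
    · obtain ⟨-, -, h⟩ := h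
      obtain ⟨-, -, h'⟩ := h'
      rcases h with ⟨rfl, rfl⟩ | ⟨rfl, rfl⟩ <;> rcases h' with ⟨rfl, rfl⟩ | ⟨rfl, rfl⟩ <;> simp
  left_mem_of_isLink := by
    rintro (e | c) x y h
    · exact h.left_mem
    · obtain ⟨h1, -, ⟨rfl, -⟩ | ⟨rfl, -⟩⟩ := h
      exacts [hp _ (by omega), hp _ h1]

/-- A levelling of order `k` turns into a unique shortest path of order `k` in a supergraph. -/
theorem IsLevelling.exists_le_paradeNumber {α : Type u} {β : Type v} {G : Graph α β}
    (hG : G.IsFiniteMultigraph) {h : α → ℤ} {p : ℕ → α} {k : ℕ} (L : G.IsLevelling h p k) :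
    ∃ (γ : Type v) (f : β ↪ γ) (G' : Graph α γ), G'.IsFiniteMultigraph ∧
      (G.relabelEdges f).IsSpanningSubgraph G' ∧ k ≤ G'.paradeNumber := by
  classical
  set label : ULift.{v} ℕ → ℕ := ULift.down
  set G' := G.addSteps p k L.mem label
  have hfin : G'.IsFiniteMultigraph := by
    refine ⟨hG.vertexSet_nonempty, hG.vertexSet_finite, ?_, ⟨?_⟩⟩
    · refine ((hG.edgeSet_finite.image Sum.inl).union
        ((Set.finite_Iio k).image fun i => Sum.inr (ULift.up i))).subset ?_
      rintro (e | c) ⟨x, y, hxy⟩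
      · exact .inl ⟨e, IsLink.edge_mem (G := G) hxy, rfl⟩
      · exact .inr ⟨c.down, lt_of_le_of_lt (Nat.le_succ _) hxy.1, rfl⟩
    · rintro (e | c) x hx
      · exact hG.loopless.not_isLoopAt e x hx
      · obtain ⟨h1, -, h2⟩ := hx
        have : p (label c) = p (label c + 1) := by
          rcases h2 with ⟨h2, h3⟩ | ⟨h2, h3⟩
          exacts [h2.symm.trans h3, h3.symm.trans h2]
        have := L.index_eq (by omega) h1 this
        omega
  have L' : G'.IsLevelling h p k := by
    refine ⟨L.mem, L.height, ?_, ?_, ?_⟩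
    · rintro (e | c) x y hxy
      · exact L.le_add_two e x y hxy
      · obtain ⟨h1, -, ⟨rfl, rfl⟩ | ⟨rfl, rfl⟩⟩ := hxy
        all_goals
          rw [L.height _ h1, L.height _ (by omega)]
          push_cast
          omega
    · rintro (e | c) i v hi he
      · exact L.near e i v hi he
      · obtain ⟨h1, -, ⟨h2, rfl⟩ | ⟨h2, rfl⟩⟩ := he
        · have := L.index_eq hi (by omega) h2
          subst this
          exact .inr (.inl ⟨h1, rfl⟩)
        · have := L.index_eq hi h1 h2
          exact .inr (.inr ⟨label c, this.symm, rfl⟩)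
    · have hc : ∀ i c, i + 1 < k → G'.IsLink (.inr c) (p i) (p (i + 1)) →
          label c = i ∧ ¬ G.Adj (p i) (p (i + 1)) := by
        rintro i c hi ⟨h1, h2, ⟨h3, -⟩ | ⟨h3, h4⟩⟩
        · have := L.index_eq (by omega) (by omega) h3
          subst this
          exact ⟨rfl, h2⟩
        · have := L.index_eq (by omega) h1 h3
          have := L.index_eq hi (by omega) h4
          omega
      rintro (e | c) (e' | c') i hi he he'
      · rw [L.edge_unique e e' i hi he he']
      · exact absurd ⟨e, he⟩ (hc i c' hi he').2
      · exact absurd ⟨e', he'⟩ (hc i c hi he).2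
      · rw [ULift.down_injective ((hc i c hi he).1.trans (hc i c' hi he').1.symm)]
  have hadj : ∀ i, ∃ e, i + 1 < k → G'.IsLink e (p i) (p (i + 1)) := by
    intro i
    by_cases h1 : G.Adj (p i) (p (i + 1))
    · obtain ⟨e, he⟩ := h1
      exact ⟨.inl e, fun _ => he⟩
    · exact ⟨.inr ⟨i⟩, fun hi => ⟨hi, h1, .inl ⟨rfl, rfl⟩⟩⟩
  choose ε hε using hadj
  refine ⟨_, .inl, G', hfin, ⟨⟨subset_rfl, ?_⟩, rfl⟩, L'.le_paradeNumber hfin hε⟩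
  rintro _ x y ⟨e, rfl, he⟩
  exact he

/-! ### Subgraphs as minors -/

theorem reflTransGen_deleteEdges (G : Graph α β) {F : Set β} (hF : F.Finite) (hFE : F ⊆ E(G)) :
    Relation.ReflTransGen IsElementaryMinor G (G.deleteEdges F) := by
  induction F, hF using Set.Finite.induction_on with
  | empty => rw [deleteEdges_empty]
  | @insert e F he _ ih =>
    have h1 : e ∈ E(G.deleteEdges F) := ⟨hFE (by simp), he⟩
    have h2 := (ih fun x hx => hFE (by simp [hx])).tail (.deleteEdge e h1)
    rwa [deleteEdges_deleteEdges, Set.union_singleton] at h2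

/-- Every spanning subgraph, up to the names of its edges, is a minor. -/
theorem isMinor_of_relabelEdges {γ : Type*} {G : Graph α β} {f : β ↪ γ} {G' : Graph α γ}
    (hfin : E(G').Finite) (hle : (G.relabelEdges f).IsSpanningSubgraph G') : G.IsMinor G' := by
  have hK : G'.deleteEdges (E(G') \ E(G.relabelEdges f)) = G.relabelEdges f := by
    refine Graph.ext hle.vertexSet_eq.symm fun e x y => ⟨fun ⟨h1, h2⟩ => ?_, fun h1 => ?_⟩
    · have : e ∈ E(G.relabelEdges f) := by
        by_contra h3
        exact h2 ⟨h1.edge_mem, h3⟩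
      exact (hle.le.isLink_iff this).2 h1
    · exact ⟨h1.mono hle.le, fun h2 => h2.2 h1.edge_mem⟩
  refine ⟨_, reflTransGen_deleteEdges G' (F := E(G') \ E(G.relabelEdges f)) hfin.sdiff
    Set.sdiff_subset, ?_⟩
  rw [hK]
  have hE : ∀ e, e ∈ E(G) ↔ f e ∈ E(G.relabelEdges f) := by
    intro e
    constructor
    · intro he
      obtain ⟨x, y, hxy⟩ := exists_isLink_of_mem_edgeSet he
      exact ⟨x, y, e, rfl, hxy⟩
    · rintro ⟨x, y, e', he', hxy⟩
      rw [← f.injective he']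
      exact hxy.edge_mem
  refine ⟨⟨Equiv.refl _, Equiv.ofBijective (fun e => ⟨f e, (hE e).1 e.2⟩) ⟨?_, ?_⟩, ?_⟩⟩
  · intro e e' h1
    exact Subtype.ext (f.injective (congrArg Subtype.val h1))
  · rintro ⟨_, x, y, e, rfl, hxy⟩
    exact ⟨⟨e, hxy.edge_mem⟩, rfl⟩
  · intro e x y
    constructor
    · exact fun h1 => ⟨e, rfl, h1⟩
    · rintro ⟨e', he', hxy⟩
      rwa [f.injective he'] at hxy

end Spectators

end Graph

theorem mainTheorem1 {α : Type u} {β : Type v} (G : Graph α β) (hG : G.IsFiniteMultigraph) :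
    ∃ (γ : Type v) (f : β ↪ γ) (G' : Graph α γ),
      G'.IsFiniteMultigraph ∧ (G.relabelEdges f).IsSpanningSubgraph G' ∧
        G'.spectatorNumber = G.spectatorFloor := by
  have hleast := Graph.isLeast_spectatorFloor hG
  obtain ⟨W, E, H, hH, ⟨K, hHK, ⟨φ⟩⟩, hfloor⟩ := hleast.1
  obtain ⟨u, q, w, hq, hpar⟩ := (Graph.isGreatest_paradeNumber hH).1
  obtain ⟨h, p, L⟩ := hq.exists_isLevelling
  obtain ⟨h₁, p₁, k, L₁, hle⟩ :=
    Graph.exists_isLevelling_of_reflTransGen hHK hH.vertexSet_finite L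
  obtain ⟨h₂, p₂, L₂⟩ := L₁.of_iso hG.vertexSet_nonempty φ
  obtain ⟨γ, f, G', hG', hsub, hk⟩ := L₂.exists_le_paradeNumber hG
  refine ⟨γ, f, G', hG', hsub, le_antisymm ?_ ?_⟩
  · have h1 := Graph.paradeNumber_add_spectatorNumber hH
    have h2 := Graph.paradeNumber_add_spectatorNumber hG'
    have h3 := φ.ncard_vertexSet_eq
    have h4 : G.vertexSet.ncard = G'.vertexSet.ncard := congrArg Set.ncard hsub.vertexSet_eq
    omega
  · exact hleast.2 ⟨α, γ, G', hG', Graph.isMinor_of_relabelEdges hG'.edgeSet_finite hsub, rfl⟩
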